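/- Let $\mathbb{A}$ be a countably infinite set, whose elements are called atoms. An \emph{orbit-finite semigroup} is a semigroup $S$ equipped with an action of the group of all permutations of $\mathbb{A}$ such that (i) every $x \in S$ has a finite support, i.e. there is a finite $\alpha \subseteq \mathbb{A}$ such that $\pi(x) = x$ for every permutation $\pi$ of $\mathbb{A}$ that fixes all elements of $\alpha$; (ii) the action has only finitely many orbits; (iii) the multiplication is equivariant: $\pi(xy) = \pi(x)\pi(y)$ for all $\pi, x, y$. Let $S^1$ denote $S$ with an identity element adjoined if $S$ has none. For $x, y \in S$, call $x$ an \emph{infix} of $y$ if $axb = y$ for some $a, b \in S^1$; call $x$ and $y$ \emph{$\mathcal{J}$-equivalent} if each is an infix of the other. A sequence of elements of $S$ is \emph{smooth} if each of its elements is $\mathcal{J}$-equivalent to the product of the whole sequence. A \emph{factorization tree} for a nonempty sequence $s_1, \ldots, s_n$ over $S$ is a finite ordered tree with nodes labelled by elements of $S$ that has exactly $n$ leaves, the $i$-th leaf from the left being labelled by $s_i$, and in which every inner node is labelled by the product of the labels of the leaves below it. It is \emph{smooth} if every inner node either has exactly two children or is such that the labels of its children, from left to right, form a smooth sequence. Its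 \emph{height} is the maximal number of edges on a path from the root to a leaf. \textbf{Theorem.} For every orbit-finite semigroup $S$ there exists $h_S \in \mathbb{N}$ such that every nonempty finite sequence $s_1, \ldots, s_n$ of elements of $S$ admits a smooth factorization tree of height at most $h_S$. -/

import Mathlib

/-- An orbit-finite semigroup over the atoms `𝔸`: a semigroup `S` with an action of all atom
permutations, such that every element has a finite support, there are finitely many orbits,
and the multiplication is equivariant. -/
structure IsOrbitFiniteSemigroup (𝔸 : Type*) (S : Type*) [Semigroup S]
    [MulAction (Equiv.Perm 𝔸) S] : Prop where
  finite_support : ∀ x : S, ∃ α : Finset 𝔸, MulAction.Supports (Equiv.Perm 𝔸) (α : Set 𝔸) x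
  finite_orbits : Finite (MulAction.orbitRel.Quotient (Equiv.Perm 𝔸) S)
  equivariant_mul : ∀ (π : Equiv.Perm 𝔸) (x y : S), π • (x * y) = (π • x) * (π • y)

/-- `x` is an infix of `y` if `a * x * b = y` for some `a, b` in `S` with an adjoined identity.
(If `S` already has an identity, adjoining a new one does not change this relation.) -/
def IsInfixOf {S : Type*} [Semigroup S] (x y : S) : Prop :=
  ∃ a b : WithOne S, a * (x : WithOne S) * b = (y : WithOne S)

/-- Infix equivalence, i.e. Green's relation `𝒥`. -/
def JEquiv {S : Type*} [Semigroup S] (x y : S) : Prop :=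
  IsInfixOf x y ∧ IsInfixOf y x

/-- The product of a sequence, computed in the monoid `WithOne S`. For a nonempty sequence it
is (the image of) the product in `S`. -/
def seqProd {S : Type*} [Semigroup S] (w : List S) : WithOne S :=
  (w.map (fun s => (s : WithOne S))).prod

/-- A sequence is smooth if each of its elements is `𝒥`-equivalent to the product `p` of the
sequence. -/
def IsSmoothSeq {S : Type*} [Semigroup S] (w : List S) : Prop :=
  ∀ s ∈ w, ∃ p : S, (p : WithOne S) = seqProd w ∧ JEquiv s p

/-- Finite ordered trees with labels in `S`, whose inner nodes have `n + 1 ≥ 1` children. -/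
inductive LabelledTree (S : Type*) where
  | leaf (s : S) : LabelledTree S
  | node (s : S) (n : ℕ) (child : Fin (n + 1) → LabelledTree S) : LabelledTree S

namespace LabelledTree

/-- The label of the root. -/
def label {S : Type*} : LabelledTree S → S
  | leaf s => s
  | node s _ _ => s

/-- The sequence of labels of the leaves, from left to right. -/
def leaves {S : Type*} : LabelledTree S → List S
  | leaf s => [s]
  | node _ _ child => (List.ofFn fun i => (child i).leaves).flatten

/-- The height, i.e. the maximal number of edges on a path from the root to a leaf. -/
def height {S : Type*} : LabelledTree S → ℕ
  | leaf _ => 0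
  | node _ _ child => (Finset.univ.sup fun i => (child i).height) + 1

/-- Every inner node is labelled by the product of the labels of the leaves below it. -/
def IsProductLabelled {S : Type*} [Semigroup S] : LabelledTree S → Prop
  | leaf _ => True
  | node s n child =>
      (s : WithOne S) = seqProd (node s n child).leaves ∧ ∀ i, (child i).IsProductLabelled

/-- `t` is a factorization tree for the sequence `w`. -/
def IsFactorizationTree {S : Type*} [Semigroup S] (t : LabelledTree S) (w : List S) : Prop :=
  t.leaves = w ∧ t.IsProductLabelled

/-- Every inner node is binary or smooth, i.e. it has exactly two children or the labels of its
children form a smooth sequence. -/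
def IsSmooth {S : Type*} [Semigroup S] : LabelledTree S → Prop
  | leaf _ => True
  | node _ n child =>
      (n + 1 = 2 ∨ IsSmoothSeq (List.ofFn fun i => (child i).label)) ∧
        ∀ i, (child i).IsSmooth

end LabelledTree

section Infix

variable {S : Type*} [Semigroup S]

/-! Rank an element by the number of orbits met by its infixes. This is bounded by the total number
of orbits and drops at every strict infix (`infixOrbits_ncard_lt`), because inside one orbit the
infix relation is symmetric up to `𝒥` (`IsInfixOf.of_smul`). Induct on the rank of the product `p`:
cut the word greedily into shortest blocks with product `𝒥`-equivalent to `p`. A block without its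
last letter, and the final remainder, have lower rank; the blocks themselves form a smooth sequence.
Each rank costs three levels. -/

theorem IsInfixOf.refl (x : S) : IsInfixOf x x := ⟨1, 1, by simp⟩

theorem IsInfixOf.trans {x y z : S} (hxy : IsInfixOf x y) (hyz : IsInfixOf y z) :
    IsInfixOf x z := by
  obtain ⟨a, b, hab⟩ := hxy
  obtain ⟨c, d, hcd⟩ := hyz
  exact ⟨c * a, b * d, by rw [← hcd, ← hab]; simp only [mul_assoc]⟩

theorem JEquiv.refl (x : S) : JEquiv x x := ⟨.refl x, .refl x⟩

theorem seqProd_append (u v : List S) : seqProd (u ++ v) = seqProd u * seqProd v := by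
  simp [seqProd]

theorem seqProd_singleton (s : S) : seqProd [s] = (s : WithOne S) := by
  simp [seqProd]

theorem exists_coe_eq_seqProd {w : List S} (hw : w ≠ []) :
    ∃ p : S, (p : WithOne S) = seqProd w := by
  induction w with
  | nil => exact absurd rfl hw
  | cons a w ih =>
    rcases eq_or_ne w [] with rfl | h
    · exact ⟨a, (seqProd_singleton a).symm⟩
    · obtain ⟨p, hp⟩ := ih h
      exact ⟨a * p, by simp_all [seqProd]⟩

theorem isInfixOf_of_seqProd {u v w : List S} {p q : S} (hp : (p : WithOne S) = seqProd v)
    (hq : (q : WithOne S) = seqProd (u ++ v ++ w)) : IsInfixOf p q :=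
  ⟨seqProd u, seqProd w, by rw [hp, hq, seqProd_append, seqProd_append]⟩

end Infix

section OrbitFinite

/-- Every permutation agrees on a given finite set with some permutation of finite order. -/
theorem Equiv.Perm.exists_isOfFinOrder_eqOn {A : Type*} (π : Equiv.Perm A) (α : Finset A) :
    ∃ σ : Equiv.Perm A, IsOfFinOrder σ ∧ ∀ a ∈ α, σ a = π a := by
  classical
  let β : Finset A := α ∪ α.image π
  -- The bijection from `α` to its image extends to a permutation of the finite set `β`, then by the
  -- identity outside.
  let e : {x : β // x.1 ∈ α} ≃ {x : β // x.1 ∈ α.image π} :=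
    { toFun := fun x => ⟨⟨π x.1.1, Finset.mem_union_right _ (Finset.mem_image_of_mem π x.2)⟩,
        Finset.mem_image_of_mem π x.2⟩
      invFun := fun x =>
        have h : π.symm x.1.1 ∈ α := by
          obtain ⟨a, ha, hax⟩ := Finset.mem_image.1 x.2
          rwa [← hax, Equiv.symm_apply_apply]
        ⟨⟨π.symm x.1.1, Finset.mem_union_left _ h⟩, h⟩
      left_inv := fun x => by simp
      right_inv := fun x => by simp }
  refine ⟨Equiv.Perm.ofSubtype e.extendSubtype,
    (Equiv.Perm.ofSubtype).isOfFinOrder (isOfFinOrder_of_finite e.extendSubtype), fun a ha => ?_⟩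
  rw [Equiv.Perm.ofSubtype_apply_of_mem _ (Finset.mem_union_left _ ha),
    e.extendSubtype_apply_of_mem ⟨a, Finset.mem_union_left _ ha⟩ ha]
  rfl

variable {A : Type*} {S : Type*} [Semigroup S] [MulAction (Equiv.Perm A) S]

theorem IsInfixOf.smul (hS : IsOrbitFiniteSemigroup A S) {x y : S} (h : IsInfixOf x y)
    (π : Equiv.Perm A) : IsInfixOf (π • x) (π • y) := by
  let f : S →ₙ* S := ⟨(π • ·), hS.equivariant_mul π⟩
  obtain ⟨a, b, hab⟩ := h
  refine ⟨WithOne.mapMulHom f a, WithOne.mapMulHom f b, ?_⟩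
  have := congrArg (WithOne.mapMulHom f) hab
  simpa [f] using this

/-- An element which is an infix of another element in its orbit is `𝒥`-equivalent to it. -/
theorem IsInfixOf.of_smul (hS : IsOrbitFiniteSemigroup A S) {x : S} {π : Equiv.Perm A}
    (h : IsInfixOf x (π • x)) : IsInfixOf (π • x) x := by
  obtain ⟨α, hα⟩ := hS.finite_support x
  obtain ⟨σ, hσ, hσα⟩ := π.exists_isOfFinOrder_eqOn α
  have hσx : σ • x = π • x := by
    rw [← inv_smul_eq_iff, smul_smul]
    refine hα _ fun a ha => ?_
    simp [hσα a ha]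
  rw [← hσx] at h ⊢
  -- Translating the hypothesis by powers of `σ` gives a chain of infixes that closes up at the
  -- order of `σ`.
  have step : ∀ n : ℕ, IsInfixOf (σ • x) (σ ^ (n + 1) • x) := fun n => by
    induction n with
    | zero => simpa using .refl _
    | succ n ih =>
      refine ih.trans ?_
      have := h.smul hS (σ ^ (n + 1))
      rwa [smul_smul, ← pow_succ] at this
  have := step (orderOf σ - 1)
  rwa [Nat.sub_add_cancel hσ.orderOf_pos, pow_orderOf_eq_one, one_smul] at this

/-- The orbits of the infixes of `x`. -/
def infixOrbits (A : Type*) {S : Type*} [Semigroup S] [MulAction (Equiv.Perm A) S] (x : S) :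
    Set (MulAction.orbitRel.Quotient (Equiv.Perm A) S) :=
  {ω | ∃ y : S, IsInfixOf y x ∧ Quotient.mk'' y = ω}

/-- The orbit of `y` itself is lost: if a translate `z` of `y` were an infix of `x`, then `z` would
be an infix of `y`, hence `y` of `z` and so of `x`. -/
theorem infixOrbits_ncard_lt (hS : IsOrbitFiniteSemigroup A S) {x y : S} (hxy : IsInfixOf x y)
    (hyx : ¬ IsInfixOf y x) : (infixOrbits A x).ncard < (infixOrbits A y).ncard := by
  have := hS.finite_orbits
  refine Set.ncard_lt_ncard ⟨?_, fun hsub => hyx ?_⟩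
  · rintro _ ⟨z, hz, rfl⟩
    exact ⟨z, hz.trans hxy, rfl⟩
  · obtain ⟨z, hzx, hz⟩ := hsub ⟨y, .refl y, rfl⟩
    obtain ⟨π, rfl⟩ := MulAction.orbitRel_apply.1 (Quotient.exact hz.symm)
    exact (IsInfixOf.of_smul hS (hzx.trans hxy)).trans hzx

end OrbitFinite

namespace LabelledTree

variable {S : Type*} [Semigroup S]

theorem IsProductLabelled.coe_label {t : LabelledTree S} (ht : t.IsProductLabelled) :
    (t.label : WithOne S) = seqProd t.leaves := by
  cases t with
  | leaf s => simp [label, leaves, seqProd]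
  | node s n child => exact ht.1

theorem seqProd_map_label {T : List (LabelledTree S)} (hT : ∀ t ∈ T, t.IsProductLabelled) :
    seqProd (T.map label) = seqProd (T.flatMap leaves) := by
  induction T with
  | nil => rfl
  | cons t T ih =>
    simp only [List.forall_mem_cons] at hT
    rw [List.map_cons, List.flatMap_cons, seqProd_append, ← ih hT.2, ← hT.1.coe_label]
    simp [seqProd]

/-- `w` has a smooth factorization tree of height at most `h`. -/
def _root_.HasSmoothTree (h : ℕ) (w : List S) : Prop :=
  ∃ t : LabelledTree S, t.IsFactorizationTree w ∧ t.IsSmooth ∧ t.height ≤ h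

theorem _root_.hasSmoothTree_singleton (h : ℕ) (s : S) : HasSmoothTree h [s] :=
  ⟨leaf s, ⟨by simp [leaves], trivial⟩, trivial, Nat.zero_le _⟩

theorem _root_.HasSmoothTree.mono {h k : ℕ} (hk : h ≤ k) {w : List S} (hw : HasSmoothTree h w) :
    HasSmoothTree k w :=
  let ⟨t, h1, h2, h3⟩ := hw
  ⟨t, h1, h2, h3.trans hk⟩

/-- Joining a list of trees under a new root. -/
theorem hasSmoothTree_flatMap {h : ℕ} {T : List (LabelledTree S)} (hne : T ≠ [])
    (hT : ∀ t ∈ T, t.IsProductLabelled ∧ t.IsSmooth ∧ t.height ≤ h)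
    (hroot : T.length = 2 ∨ IsSmoothSeq (T.map label)) :
    HasSmoothTree (h + 1) (T.flatMap leaves) := by
  obtain ⟨t, T, rfl⟩ := List.exists_cons_of_ne_nil hne
  obtain ⟨p, hp⟩ : ∃ p : S, (p : WithOne S) = seqProd ((t :: T).flatMap leaves) := by
    rw [← seqProd_map_label fun t ht => (hT t ht).1]
    exact exists_coe_eq_seqProd (by simp)
  have hmap : ∀ {β : Type _} (f : LabelledTree S → β),
      (List.ofFn fun i : Fin (T.length + 1) => f ((t :: T).get i)) = (t :: T).map f :=
    fun f => List.ofFn_getElem_eq_map (t :: T) f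
  have hget : ∀ i : Fin (T.length + 1), (t :: T).get i ∈ t :: T := fun i => List.get_mem (t :: T) i
  have hleaves : (node p T.length (t :: T).get).leaves = (t :: T).flatMap leaves := by
    rw [leaves, List.flatMap_def]
    exact congrArg List.flatten (hmap leaves)
  refine ⟨node p T.length (t :: T).get, ⟨hleaves, ?_⟩, ⟨?_, fun i => (hT _ (hget i)).2.1⟩, ?_⟩
  · exact ⟨by rw [hleaves, hp], fun i => (hT _ (hget i)).1⟩
  · exact hroot.imp_right fun hs => (hmap label).symm ▸ hs
  · exact Nat.succ_le_succ (Finset.sup_le fun i _ => (hT _ (hget i)).2.2)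

theorem _root_.HasSmoothTree.append {h : ℕ} {u v : List S} (hu : HasSmoothTree h u)
    (hv : HasSmoothTree h v) : HasSmoothTree (h + 1) (u ++ v) := by
  obtain ⟨s, ⟨rfl, hs⟩, hs'⟩ := hu
  obtain ⟨t, ⟨rfl, ht⟩, ht'⟩ := hv
  have := hasSmoothTree_flatMap (h := h) (T := [s, t]) (by simp)
    (by simpa using ⟨⟨hs, hs'⟩, ht, ht'⟩) (Or.inl rfl)
  simpa using this

/-- If all words with products strictly `𝒥`-above `p` have smooth trees of height at most `h`,
then every word whose product is an infix of `p` can be cut into blocks whose products are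
`𝒥`-equivalent to `p`, each with a smooth tree of height at most `h + 1`, and a remainder
whose product is not `𝒥`-equivalent to `p`. -/
theorem exists_blocks {h : ℕ} {p : S}
    (ih : ∀ v : List S, v ≠ [] → ∀ q : S, (q : WithOne S) = seqProd v → IsInfixOf q p →
      ¬ JEquiv q p → HasSmoothTree h v)
    (w : List S) (hw : ∀ q : S, (q : WithOne S) = seqProd w → IsInfixOf q p) :
    ∃ (T : List (LabelledTree S)) (v : List S), T.flatMap leaves ++ v = w ∧
      (∀ t ∈ T, t.IsProductLabelled ∧ t.IsSmooth ∧ t.height ≤ h + 1) ∧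
      (∀ t ∈ T, JEquiv t.label p) ∧
      ∀ q : S, (q : WithOne S) = seqProd v → IsInfixOf q p ∧ ¬ JEquiv q p := by
  induction w using List.reverseRecOn with
  | nil => exact ⟨[], [], rfl, by simp, by simp, fun q hq => absurd hq (by simp [seqProd])⟩
  | append_singleton w a IH =>
    obtain ⟨r, hr⟩ := exists_coe_eq_seqProd (w := w ++ [a]) (by simp)
    have hrp := hw r hr
    obtain ⟨T, v, rfl, hT, hTp, hv⟩ := IH fun q hq =>
      (isInfixOf_of_seqProd (u := []) hq (by simpa using hr)).trans hrp
    obtain ⟨q, hq⟩ := exists_coe_eq_seqProd (w := v ++ [a]) (by simp)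
    have hqp : IsInfixOf q p :=
      (isInfixOf_of_seqProd (w := []) hq (by simpa using hr)).trans hrp
    -- The current block closes as soon as its product falls into the `𝒥`-class of `p`.
    by_cases hJ : JEquiv q p
    · have hblock : HasSmoothTree (h + 1) (v ++ [a]) := by
        rcases eq_or_ne v [] with rfl | hne
        · exact hasSmoothTree_singleton _ a
        · obtain ⟨s, hs⟩ := exists_coe_eq_seqProd hne
          exact (ih v hne s hs (hv s hs).1 (hv s hs).2).append (hasSmoothTree_singleton h a)
      obtain ⟨t, ⟨htv, ht⟩, ht'⟩ := hblock
      have htq : t.label = q := WithOne.coe_injective (by rw [ht.coe_label, htv, hq])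
      refine ⟨T ++ [t], [], by simp [htv], ?_, ?_, fun q hq => absurd hq (by simp [seqProd])⟩
      · simpa only [List.forall_mem_append, List.forall_mem_singleton] using ⟨hT, ht, ht'⟩
      · simpa only [List.forall_mem_append, List.forall_mem_singleton] using ⟨hTp, htq ▸ hJ⟩
    · refine ⟨T, v ++ [a], by simp, hT, hTp, fun q' hq' => ?_⟩
      obtain rfl : q' = q := WithOne.coe_injective (hq'.trans hq.symm)
      exact ⟨hqp, hJ⟩

/-- The three levels: attaching the last letter of a block, the smooth node over all blocks, and
attaching the remainder. -/
theorem hasSmoothTree_of_strict_infixes {h : ℕ} {p : S}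
    (ih : ∀ v : List S, v ≠ [] → ∀ q : S, (q : WithOne S) = seqProd v → IsInfixOf q p →
      ¬ JEquiv q p → HasSmoothTree h v)
    {w : List S} (hp : (p : WithOne S) = seqProd w) : HasSmoothTree (h + 3) w := by
  obtain ⟨T, v, rfl, hT, hTp, hv⟩ := exists_blocks ih w fun q hq =>
    WithOne.coe_injective (hq.trans hp.symm) ▸ .refl q
  have hne : T ≠ [] := by
    rintro rfl
    exact (hv p (by simpa using hp)).2 (.refl p)
  have hprod := seqProd_map_label fun t ht => (hT t ht).1
  have hsmooth : IsSmoothSeq (T.map label) := by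
    obtain ⟨r, hr⟩ := exists_coe_eq_seqProd (w := T.map label) (by simpa using hne)
    have hrp : IsInfixOf r p :=
      isInfixOf_of_seqProd (u := []) (hr.trans hprod) (by simpa using hp)
    intro s hs
    obtain ⟨t, ht, rfl⟩ := List.mem_map.1 hs
    obtain ⟨l₁, l₂, hl⟩ := List.append_of_mem hs
    have htr : IsInfixOf t.label r :=
      isInfixOf_of_seqProd (u := l₁) (w := l₂) (seqProd_singleton _).symm (by simpa [← hl] using hr)
    -- The product `r` of the blocks lies between a block and `p`, which are `𝒥`-equivalent.
    exact ⟨r, hr, htr, hrp.trans (hTp t ht).2⟩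
  have hblocks := hasSmoothTree_flatMap hne hT (Or.inr hsmooth)
  rcases eq_or_ne v [] with rfl | hvne
  · simpa using hblocks.mono (Nat.le_succ _)
  · obtain ⟨q, hq⟩ := exists_coe_eq_seqProd hvne
    exact hblocks.append ((ih v hvne q hq (hv q hq).1 (hv q hq).2).mono (by omega))

end LabelledTree

theorem hasSmoothTree_of_infixOrbits_ncard_le {A S : Type*} [Semigroup S]
    [MulAction (Equiv.Perm A) S] (hS : IsOrbitFiniteSemigroup A S) (d : ℕ) (w : List S) (p : S)
    (hp : (p : WithOne S) = seqProd w) (hd : (infixOrbits A p).ncard ≤ d) :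
    HasSmoothTree (3 * (d + 1)) w := by
  induction d generalizing w p with
  | zero =>
    -- At rank zero there are no strict infixes.
    refine (LabelledTree.hasSmoothTree_of_strict_infixes (h := 0) (fun v _ q _ hqp hJ => ?_) hp)
    have := infixOrbits_ncard_lt hS hqp fun h => hJ ⟨hqp, h⟩
    omega
  | succ d IH =>
    refine (LabelledTree.hasSmoothTree_of_strict_infixes (fun v _ q hq hqp hJ => ?_) hp)
    have := infixOrbits_ncard_lt hS hqp fun h => hJ ⟨hqp, h⟩
    exact IH v q hq (by omega)

theorem mainTheorem6 {𝔸 : Type*} [Countable 𝔸] [Infinite 𝔸]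
    {S : Type*} [Semigroup S] [MulAction (Equiv.Perm 𝔸) S]
    (hS : IsOrbitFiniteSemigroup 𝔸 S) :
    ∃ h : ℕ, ∀ w : List S, w ≠ [] →
      ∃ t : LabelledTree S, t.IsFactorizationTree w ∧ t.IsSmooth ∧ t.height ≤ h := by
  have := hS.finite_orbits
  refine ⟨3 * (Nat.card (MulAction.orbitRel.Quotient (Equiv.Perm 𝔸) S) + 1), fun w hw => ?_⟩
  obtain ⟨p, hp⟩ := exists_coe_eq_seqProd hw
  exact hasSmoothTree_of_infixOrbits_ncard_le hS _ w p hp (Set.ncard_le_card _)
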